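/- For a positive integer $n$ let $\sigma(n)$ be the sum of the positive divisors of $n$ and let $I(n)=\sigma(n)/n$. An integer $N>10$ is called a friend of $10$ if $I(N)=I(10)=9/5$. Every friend $N$ of $10$ has at least $7$ distinct prime factors. Moreover, every friend $N$ of $10$ has prime factors $p$ and $q$, not necessarily distinct, such that $p\equiv 1 \pmod{10}$ and $q\equiv 1 \pmod 6$. -/

import Mathlib

/-- The abundancy index `I(n) = σ(n) / n` of a natural number, as a rational number. -/
def abundancyIndex (n : ℕ) : ℚ :=
  (ArithmeticFunction.sigma 1 n : ℚ) / (n : ℚ)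

/-- `N` is a friend of `10`: an integer `N > 10` with the same abundancy index as `10`. -/
def IsFriendOfTen (N : ℕ) : Prop :=
  10 < N ∧ abundancyIndex N = abundancyIndex 10

/-- The common value of the abundancy index is `9 / 5`. -/
theorem abundancyIndex_ten : abundancyIndex 10 = 9 / 5 := by
  have h : ArithmeticFunction.sigma 1 10 = 18 := by decide
  rw [abundancyIndex, h]
  norm_num

/-! The equation is 5σ(N) = 9N, so 5 ∣ N. Moreover N is odd, hence so is σ(N), and every exponent e
in N is even; 3 ∤ N, since otherwise some divisor of N has index above 9/5. Thus 25 ∣ N, and σ(N) =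
∏ (1 + p + ⋯ + p ^ e) is divisible by 5 and by 9. As e + 1 is odd, 5 or 3 divides a factor only if p
≡ 1 modulo it and it divides e + 1 (`modEq_one_and_dvd_of_dvd_geomSum`). This gives both
congruences.

Suppose there are at most six primes. The bound 9/5 ≤ ∏ p / (p - 1) forces 7 ∣ N and 11 ∣ N. Take p
≡ 1 mod 10 with 5 ∣ e + 1: all primes dividing 1 + p + ⋯ + p ^ 4 divide N, and each is 5 or 1 mod
10. If p = 11, then 3221 ∣ N, which is impossible. If p > 11, a new prime other than 5 and 11 makes
the product too small, and a computation finds one whenever p < 20800. For larger p the primes are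
5, 7, 11, 13, 23, p; only p can supply the factor 9 of σ(N), so 9 ∣ e + 1 and p ^ 6 + p ^ 3 + 1
yields a seventh prime. -/

open Finset

/-! ### Geometric sums and their divisibility -/

/-- The geometric sum `1 + p + ⋯ + p ^ (n - 1)`. -/
def geomSum (p n : ℕ) : ℕ := ∑ i ∈ range n, p ^ i

theorem sigma_one_eq_prod_geomSum {N : ℕ} (hN : N ≠ 0) :
    ArithmeticFunction.sigma 1 N =
      ∏ p ∈ N.primeFactors, geomSum p (N.factorization p + 1) := by
  rw [ArithmeticFunction.sigma_eq_prod_primeFactors_sum_range_factorization_pow_mul hN]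
  simp [geomSum]

theorem geomSum_mul (q m n : ℕ) : geomSum q (m * n) = geomSum q m * geomSum (q ^ m) n := by
  induction n with
  | zero => simp [geomSum]
  | succ n ih =>
    have h1 : geomSum q (m * (n + 1)) = geomSum q (m * n) + q ^ (m * n) * geomSum q m := by
      simp only [geomSum, mul_add, mul_one, sum_range_add, mul_sum, pow_add]
    have h2 : geomSum (q ^ m) (n + 1) = geomSum (q ^ m) n + q ^ (m * n) := by
      simp [geomSum, sum_range_succ, pow_mul]
    rw [h1, h2, ih]
    ring

theorem geomSum_dvd_geomSum (q : ℕ) {m n : ℕ} (h : m ∣ n) : geomSum q m ∣ geomSum q n := by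
  obtain ⟨k, rfl⟩ := h
  exact ⟨_, geomSum_mul q m k⟩

theorem geomSum_modEq {q m : ℕ} (h : q ≡ 1 [MOD m]) (n : ℕ) : geomSum q n ≡ n [MOD m] := by
  induction n with
  | zero => simp [geomSum]; rfl
  | succ n ih =>
    have h1 : geomSum q (n + 1) = geomSum q n + q ^ n := by simp [geomSum, sum_range_succ]
    rw [h1]
    simpa using ih.add (h.pow n)

theorem geomSum_mul_sub_one (p n : ℕ) : (geomSum p n : ℤ) * (p - 1) = p ^ n - 1 := by
  simpa [geomSum] using geom_sum_mul (p : ℤ) n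

/-- If a prime `l` divides `1 + q + ⋯ + q ^ (n - 1)` with `n` coprime to `l - 1`, then
`q ≡ 1 [MOD l]` and `l ∣ n`. -/
theorem modEq_one_and_dvd_of_dvd_geomSum {l q n : ℕ} (hl : l.Prime) (hn : n ≠ 0)
    (hc : n.Coprime (l - 1)) (h : l ∣ geomSum q n) : q ≡ 1 [MOD l] ∧ l ∣ n := by
  have := Fact.mk hl
  have h1 : (q : ZMod l) ^ n = 1 := by
    have h2 := congrArg (Int.cast : ℤ → ZMod l) (geomSum_mul_sub_one q n)
    push_cast at h2
    rw [(ZMod.natCast_eq_zero_iff _ _).2 h, zero_mul] at h2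
    exact (sub_eq_zero.1 h2.symm)
  have hq : (q : ZMod l) ≠ 0 := by
    intro h0
    rw [h0, zero_pow hn] at h1
    exact zero_ne_one h1
  -- The order of q divides both n and l - 1, which are coprime.
  have h3 : (q : ZMod l) = 1 := by
    have := Nat.dvd_gcd (orderOf_dvd_of_pow_eq_one h1)
      (orderOf_dvd_of_pow_eq_one (ZMod.pow_card_sub_one_eq_one hq))
    rw [hc.gcd_eq_one, Nat.dvd_one] at this
    exact orderOf_eq_one_iff.1 this
  have h4 : q ≡ 1 [MOD l] := (ZMod.natCast_eq_natCast_iff _ _ _).1 (by simpa using h3)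
  exact ⟨h4, (Nat.modEq_zero_iff_dvd.1 ((geomSum_modEq h4 n).symm.trans
    (Nat.modEq_zero_iff_dvd.2 h)))⟩

/-- With n = 3m, the sum is `geomSum q 3` ≡ 3 mod 9 times a sum ≡ m mod 9, as q ^ 3 ≡ 1 mod 9. -/
theorem nine_dvd_of_nine_dvd_geomSum {q n : ℕ} (hq : q ≡ 1 [MOD 3]) (h : 9 ∣ geomSum q n) :
    9 ∣ n := by
  have h3 : 3 ∣ n := Nat.modEq_zero_iff_dvd.1 ((geomSum_modEq hq n).symm.trans
    (Nat.modEq_zero_iff_dvd.2 (dvd_trans (by norm_num) h)))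
  obtain ⟨m, rfl⟩ := h3
  rw [geomSum_mul] at h
  have h9 : q % 9 = 1 ∨ q % 9 = 4 ∨ q % 9 = 7 := by
    unfold Nat.ModEq at hq
    omega
  have hcube : q ^ 3 ≡ 1 [MOD 9] := by
    rcases h9 with h9 | h9 | h9 <;> simp [Nat.ModEq, Nat.pow_mod, h9]
  have hsum : geomSum q 3 ≡ 3 [MOD 9] := by
    have : geomSum q 3 = 1 + q + q ^ 2 := by simp [geomSum, sum_range_succ]
    rw [this]
    rcases h9 with h9 | h9 | h9 <;> simp [Nat.ModEq, Nat.pow_mod, Nat.add_mod, h9]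
  have h5 := (hsum.mul (geomSum_modEq hcube m)).symm.trans (Nat.modEq_zero_iff_dvd.2 h)
  have := Nat.modEq_zero_iff_dvd.1 h5
  omega

/-! ### Prime factors of 1 + p + p ^ 2 + p ^ 3 + p ^ 4 -/

theorem geomSum_five (p : ℕ) : geomSum p 5 = 1 + p + p ^ 2 + p ^ 3 + p ^ 4 := by
  simp [geomSum, sum_range_succ]

theorem not_twentyfive_dvd_geomSum_five (p : ℕ) : ¬ 25 ∣ geomSum p 5 := by
  have h : ∀ r < 25, (1 + r + r ^ 2 + r ^ 3 + r ^ 4) % 25 ≠ 0 := by decide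
  have h1 := h (p % 25) (Nat.mod_lt _ (by norm_num))
  rw [geomSum_five, Nat.dvd_iff_mod_eq_zero]
  simpa [Nat.add_mod, Nat.pow_mod] using h1

theorem prime_dvd_geomSum_five {r p : ℕ} (hr : r.Prime) (h : r ∣ geomSum p 5) :
    r = 5 ∨ r ≡ 1 [MOD 10] := by
  by_cases hc : Nat.Coprime 5 (r - 1)
  · have := (modEq_one_and_dvd_of_dvd_geomSum hr (by norm_num) hc h).2
    exact .inl ((Nat.prime_dvd_prime_iff_eq hr (by norm_num)).1 this)
  · have h5 : 5 ∣ r - 1 := by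
      by_contra h5
      exact hc ((Nat.Prime.coprime_iff_not_dvd (by norm_num)).2 h5)
    have h2 : r % 2 = 1 ∨ r = 2 := hr.eq_two_or_odd.symm
    have := hr.two_le
    right
    unfold Nat.ModEq
    omega

/-- Turns "all prime factors lie in a given list" into one decidable divisibility, without
factoring; exponents in n are below log₂ of the bound. -/
theorem dvd_pow_of_primes_dvd {n R K : ℕ} (hn : n ≠ 0) (hK : n < 2 ^ K)
    (h : ∀ p : ℕ, p.Prime → p ∣ n → p ∣ R) : n ∣ R ^ K := by
  rw [Nat.dvd_iff_prime_pow_dvd_dvd]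
  intro p k hp hk
  rcases Nat.eq_zero_or_pos k with rfl | hk0
  · simp
  have h1 : p ^ k ≤ n := Nat.le_of_dvd (Nat.pos_of_ne_zero hn) hk
  have h2 : 2 ^ k < 2 ^ K := ((Nat.pow_le_pow_left hp.two_le k).trans h1).trans_lt hK
  have h3 : k ≤ K := ((Nat.pow_lt_pow_iff_right (by norm_num)).1 h2).le
  exact (pow_dvd_pow_of_dvd (h p hp ((dvd_pow_self p hk0.ne').trans hk)) k).trans (pow_dvd_pow R h3)

theorem exists_prime_dvd_geomSum_five_of_lt {p : ℕ} (hp : p ≡ 1 [MOD 10]) (h1 : p ≠ 1)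
    (h : p < 20800) : ∃ r : ℕ, r.Prime ∧ r ∣ geomSum p 5 ∧ r ≠ 5 ∧ r ≠ 11 := by
  by_contra! hall
  obtain ⟨m, rfl⟩ : ∃ m, p = 10 * m + 11 := ⟨p / 10 - 1, by unfold Nat.ModEq at hp; omega⟩
  have hd : geomSum (10 * m + 11) 5 ∣ 55 ^ 60 := by
    refine dvd_pow_of_primes_dvd ?_ ?_ ?_
    · rw [geomSum_five]; positivity
    · rw [geomSum_five]
      calc _ ≤ 1 + 20800 + 20800 ^ 2 + 20800 ^ 3 + 20800 ^ 4 := by gcongr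
        _ < 2 ^ 60 := by norm_num
    · intro r hr hrd
      by_cases h5 : r = 5
      · subst h5; norm_num
      · rw [hall r hr hrd h5]; norm_num
  rw [geomSum_five] at hd
  -- Here m = 100a + b, and p < 20800 gives m ≤ 2078.
  have key : ∀ a < 21, ∀ b < 100, ¬ (1 + (10 * (100 * a + b) + 11) + (10 * (100 * a + b) + 11) ^ 2 +
      (10 * (100 * a + b) + 11) ^ 3 + (10 * (100 * a + b) + 11) ^ 4 ∣ 55 ^ 60) := by
    decide +kernel
  apply key (m / 100) (by omega) (m % 100) (Nat.mod_lt _ (by norm_num))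
  rwa [Nat.div_add_mod]

theorem exists_prime_dvd_geomSum_five_ne_thirtyone {p : ℕ} (hp : p ≡ 1 [MOD 10]) (h1 : p ≠ 1)
    (h : p < 431) : ∃ r : ℕ, r.Prime ∧ r ∣ geomSum p 5 ∧ r ≠ 5 ∧ r ≠ 11 ∧ r ≠ 31 := by
  by_contra! hall
  obtain ⟨m, rfl⟩ : ∃ m, p = 10 * m + 11 := ⟨p / 10 - 1, by unfold Nat.ModEq at hp; omega⟩
  have hd : geomSum (10 * m + 11) 5 ∣ 1705 ^ 40 := by
    refine dvd_pow_of_primes_dvd ?_ ?_ ?_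
    · rw [geomSum_five]; positivity
    · rw [geomSum_five]
      calc _ ≤ 1 + 431 + 431 ^ 2 + 431 ^ 3 + 431 ^ 4 := by gcongr
        _ < 2 ^ 40 := by norm_num
    · intro r hr hrd
      by_cases h5 : r = 5
      · subst h5; norm_num
      by_cases h11 : r = 11
      · subst h11; norm_num
      · rw [hall r hr hrd h5 h11]; norm_num
  rw [geomSum_five] at hd
  have key : ∀ m < 42, ¬ (1 + (10 * m + 11) + (10 * m + 11) ^ 2 +
      (10 * m + 11) ^ 3 + (10 * m + 11) ^ 4 ∣ 1705 ^ 40) := by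
    decide +kernel
  exact key m (by omega) hd

/-! ### Arithmetic constraints on a friend of 10 -/

/-- Multiplication by k embeds the divisors of d in those of dk; hence the index of a divisor never
exceeds that of the number. -/
theorem mul_sigma_le_sigma {d k : ℕ} (h : d * k ≠ 0) :
    k * ArithmeticFunction.sigma 1 d ≤ ArithmeticFunction.sigma 1 (d * k) := by
  rw [ArithmeticFunction.sigma_one_apply, ArithmeticFunction.sigma_one_apply, mul_sum]
  have hk : k ≠ 0 := right_ne_zero_of_mul h
  rw [← sum_image (f := fun x => x) (g := fun x => k * x)
    (fun x _ y _ hxy => Nat.eq_of_mul_eq_mul_left (Nat.pos_of_ne_zero hk) hxy)]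
  refine sum_le_sum_of_subset fun x hx => ?_
  obtain ⟨y, hy, rfl⟩ := mem_image.1 hx
  rw [Nat.mem_divisors] at hy ⊢
  exact ⟨by rw [mul_comm d]; exact mul_dvd_mul_left k hy.1, h⟩

theorem exists_mem_dvd_geomSum {N l : ℕ} (hl : l.Prime) (hN : N ≠ 0)
    (h : l ∣ ArithmeticFunction.sigma 1 N) :
    ∃ p ∈ N.primeFactors, l ∣ geomSum p (N.factorization p + 1) := by
  rw [sigma_one_eq_prod_geomSum hN] at h
  exact (hl.prime.dvd_finsetProd_iff _).1 h

namespace IsFriendOfTen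

variable {N : ℕ}

theorem ne_zero (hN : IsFriendOfTen N) : N ≠ 0 := (lt_trans (by norm_num) hN.1).ne'

theorem five_mul_sigma (hN : IsFriendOfTen N) : 5 * ArithmeticFunction.sigma 1 N = 9 * N := by
  have h := hN.2
  have h0 : (N : ℚ) ≠ 0 := by exact_mod_cast hN.ne_zero
  rw [abundancyIndex_ten, abundancyIndex, div_eq_div_iff h0 (by norm_num)] at h
  have : ArithmeticFunction.sigma 1 N * 5 = 9 * N := by exact_mod_cast h
  omega

theorem five_dvd (hN : IsFriendOfTen N) : 5 ∣ N := by
  have := hN.five_mul_sigma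
  omega

theorem five_mul_sigma_le (hN : IsFriendOfTen N) {d : ℕ} (hd : d ∣ N) :
    5 * ArithmeticFunction.sigma 1 d ≤ 9 * d := by
  obtain ⟨k, rfl⟩ := hd
  have h1 := mul_sigma_le_sigma hN.ne_zero
  have h2 := hN.five_mul_sigma
  have hk : 0 < k := Nat.pos_of_ne_zero (right_ne_zero_of_mul hN.ne_zero)
  refine le_of_mul_le_mul_left (a := k) ?_ hk
  linarith

theorem odd (hN : IsFriendOfTen N) : N % 2 = 1 := by
  by_contra h
  obtain ⟨m, rfl⟩ : ∃ m, N = 10 * m := ⟨N / 10, by have := hN.five_dvd; omega⟩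
  have hm : 1 < m := by have := hN.1; omega
  -- These divisors sum to 18m + 1 > 18m = σ(N). They are distinct because m > 1, which is where N >
  -- 10 enters.
  have hsub : ({1, m, 2 * m, 5 * m, 10 * m} : Finset ℕ) ⊆ (10 * m).divisors := by
    intro x hx
    simp only [mem_insert, mem_singleton] at hx
    rw [Nat.mem_divisors]
    refine ⟨?_, by omega⟩
    rcases hx with rfl | rfl | rfl | rfl | rfl
    · exact one_dvd _
    · exact ⟨10, by ring⟩
    · exact ⟨5, by ring⟩
    · exact ⟨2, by ring⟩
    · exact dvd_rfl
  have h1 := sum_le_sum_of_subset (f := fun x => x) hsub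
  rw [← ArithmeticFunction.sigma_one_apply] at h1
  rw [sum_insert, sum_insert, sum_insert, sum_insert, sum_singleton] at h1
  · have := hN.five_mul_sigma
    omega
  all_goals simp only [mem_insert, mem_singleton]; omega

theorem odd_prime (hN : IsFriendOfTen N) {p : ℕ} (hp : p ∣ N) : p % 2 = 1 := by
  by_contra h
  have := (show 2 ∣ p by omega).trans hp
  have := hN.odd
  omega

theorem even_factorization (hN : IsFriendOfTen N) {p : ℕ} (hp : p ∈ N.primeFactors) :
    N.factorization p % 2 = 0 := by
  have h1 : ¬ 2 ∣ ArithmeticFunction.sigma 1 N := by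
    have := hN.five_mul_sigma
    have := hN.odd
    omega
  rw [sigma_one_eq_prod_geomSum hN.ne_zero] at h1
  have h2 : geomSum p (N.factorization p + 1) % 2 = (N.factorization p + 1) % 2 :=
    geomSum_modEq (hN.odd_prime (Nat.dvd_of_mem_primeFactors hp)) _
  by_contra h
  exact h1 ((show 2 ∣ geomSum p (N.factorization p + 1) by omega).trans (dvd_prod_of_mem _ hp))

theorem dvd_nine_mul (hN : IsFriendOfTen N) {p n r : ℕ} (hp : p ∈ N.primeFactors)
    (hn : n ∣ N.factorization p + 1) (hr : r ∣ geomSum p n) : r ∣ 9 * N := by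
  rw [← hN.five_mul_sigma, sigma_one_eq_prod_geomSum hN.ne_zero]
  exact ((hr.trans (geomSum_dvd_geomSum p hn)).trans
    (dvd_prod_of_mem (fun p => geomSum p (N.factorization p + 1)) hp)).mul_left 5

theorem mem_primeFactors (hN : IsFriendOfTen N) {p n r : ℕ} (hp : p ∈ N.primeFactors)
    (hn : n ∣ N.factorization p + 1) (hr : r.Prime) (h3 : r ≠ 3) (hd : r ∣ geomSum p n) :
    r ∈ N.primeFactors := by
  refine Nat.mem_primeFactors.2 ⟨hr, ?_, hN.ne_zero⟩
  rcases hr.dvd_mul.1 (hN.dvd_nine_mul hp hn hd) with h | h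
  · have h9 : r ∣ 3 ^ 2 := h
    exact absurd ((Nat.prime_dvd_prime_iff_eq hr Nat.prime_three).1 (hr.dvd_of_dvd_pow h9)) h3
  · exact h

theorem sq_dvd (hN : IsFriendOfTen N) {p : ℕ} (hp : p ∈ N.primeFactors) : p ^ 2 ∣ N := by
  have h1 := hN.even_factorization hp
  have h2 := (Nat.prime_of_mem_primeFactors hp).factorization_pos_of_dvd hN.ne_zero
    (Nat.dvd_of_mem_primeFactors hp)
  exact (pow_dvd_pow p (by omega)).trans (Nat.ordProj_dvd N p)

theorem five_mem (hN : IsFriendOfTen N) : 5 ∈ N.primeFactors :=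
  Nat.mem_primeFactors.2 ⟨by norm_num, hN.five_dvd, hN.ne_zero⟩

theorem not_three_dvd (hN : IsFriendOfTen N) : ¬ 3 ∣ N := by
  intro h
  have h3 : 3 ∈ N.primeFactors := Nat.mem_primeFactors.2 ⟨by norm_num, h, hN.ne_zero⟩
  have h25 := hN.sq_dvd hN.five_mem
  have hs5 : ArithmeticFunction.sigma 1 (5 ^ 2) = 31 := by decide
  have hmul : ∀ {a b : ℕ}, a.Coprime b → ArithmeticFunction.sigma 1 (a * b) =
      ArithmeticFunction.sigma 1 a * ArithmeticFunction.sigma 1 b := fun hab =>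
    ArithmeticFunction.isMultiplicative_sigma.map_mul_of_coprime hab
  -- Either 3 ^ 4 * 5 ^ 2 divides N, or the exponent of 3 is 2 and σ(9) = 13 brings in 13; both
  -- divisors have index above 9/5.
  by_cases h4 : 3 ^ 4 ∣ N
  · have hc : Nat.Coprime (3 ^ 4) (5 ^ 2) := by norm_num
    have h5 := hN.five_mul_sigma_le (hc.mul_dvd_of_dvd_of_dvd h4 h25)
    rw [hmul hc, hs5, ArithmeticFunction.sigma_one_apply_prime_pow Nat.prime_three] at h5
    norm_num [sum_range_succ] at h5
  · have h5 := hN.even_factorization h3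
    have h6 : N.factorization 3 < 4 := by
      by_contra h6
      exact h4 ((Nat.prime_three.pow_dvd_iff_le_factorization hN.ne_zero).2 (by omega))
    have h7 := Nat.prime_three.factorization_pos_of_dvd hN.ne_zero h
    have h8 : 3 ∣ N.factorization 3 + 1 := by
      rw [show N.factorization 3 = 2 by omega]
    have h13 := Nat.dvd_of_mem_primeFactors (hN.mem_primeFactors (r := 13) h3 h8 (by norm_num)
      (by norm_num) (by decide))
    have hc : Nat.Coprime (3 ^ 2) (5 ^ 2) := by norm_num
    have hc' : Nat.Coprime (3 ^ 2 * 5 ^ 2) 13 := by norm_num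
    have h9 := hN.five_mul_sigma_le (hc'.mul_dvd_of_dvd_of_dvd
      (hc.mul_dvd_of_dvd_of_dvd (hN.sq_dvd h3) h25) h13)
    rw [hmul hc', hmul hc, hs5, ArithmeticFunction.sigma_one_apply_prime_pow Nat.prime_three,
      show ArithmeticFunction.sigma 1 13 = 14 by decide] at h9
    norm_num [sum_range_succ] at h9

theorem five_le (hN : IsFriendOfTen N) {p : ℕ} (hp : p ∈ N.primeFactors) : 5 ≤ p := by
  have h1 := Nat.prime_of_mem_primeFactors hp
  have h2 := Nat.dvd_of_mem_primeFactors hp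
  have h3 := hN.odd_prime h2
  by_contra h
  have := h1.two_le
  interval_cases p
  · omega
  · exact hN.not_three_dvd h2
  · omega

theorem exists_modEq_one_five (hN : IsFriendOfTen N) :
    ∃ p ∈ N.primeFactors, p ≡ 1 [MOD 10] ∧ 5 ∣ N.factorization p + 1 := by
  have h25 := hN.sq_dvd hN.five_mem
  have h5 : 5 ∣ ArithmeticFunction.sigma 1 N := by
    have := hN.five_mul_sigma
    omega
  obtain ⟨p, hp, hd⟩ := exists_mem_dvd_geomSum (by norm_num) hN.ne_zero h5
  have he := hN.even_factorization hp
  have hc : Nat.Coprime (N.factorization p + 1) (5 - 1) :=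
    Nat.Coprime.pow_right 2 (Nat.Coprime.symm ((Nat.prime_two.coprime_iff_not_dvd).2 (by omega)))
  obtain ⟨h1, h2⟩ := modEq_one_and_dvd_of_dvd_geomSum (by norm_num) (by omega) hc hd
  refine ⟨p, hp, ?_, h2⟩
  have := hN.odd_prime (Nat.dvd_of_mem_primeFactors hp)
  unfold Nat.ModEq at *
  omega

theorem modEq_one_three (hN : IsFriendOfTen N) {p : ℕ} (hp : p ∈ N.primeFactors)
    (hd : 3 ∣ geomSum p (N.factorization p + 1)) :
    p ≡ 1 [MOD 3] ∧ 3 ∣ N.factorization p + 1 := by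
  have he := hN.even_factorization hp
  have hc : Nat.Coprime (N.factorization p + 1) (3 - 1) :=
    Nat.Coprime.symm ((Nat.prime_two.coprime_iff_not_dvd).2 (by omega))
  exact modEq_one_and_dvd_of_dvd_geomSum (by norm_num) (by omega) hc hd

theorem nine_dvd_sigma (hN : IsFriendOfTen N) : 9 ∣ ArithmeticFunction.sigma 1 N := by
  have := hN.five_mul_sigma
  omega

theorem exists_modEq_one_three (hN : IsFriendOfTen N) :
    ∃ q ∈ N.primeFactors, q ≡ 1 [MOD 3] ∧ 3 ∣ N.factorization q + 1 := by
  obtain ⟨q, hq, hd⟩ := exists_mem_dvd_geomSum Nat.prime_three hN.ne_zero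
    (dvd_trans (by norm_num) hN.nine_dvd_sigma)
  exact ⟨q, hq, hN.modEq_one_three hq hd⟩

/-- If only the prime `p` has an exponent `e` with `3 ∣ e + 1`, then `9` divides its `e + 1`. -/
theorem nine_dvd_factorization (hN : IsFriendOfTen N) {p : ℕ} (hp : p ∈ N.primeFactors)
    (h : ∀ q ∈ N.primeFactors, q ≡ 1 [MOD 3] → 3 ∣ N.factorization q + 1 → q = p) :
    p ≡ 1 [MOD 3] ∧ 9 ∣ N.factorization p + 1 := by
  obtain ⟨q, hq, h1, h3⟩ := hN.exists_modEq_one_three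
  obtain rfl := h q hq h1 h3
  refine ⟨h1, nine_dvd_of_nine_dvd_geomSum h1 ?_⟩
  have h9 := hN.nine_dvd_sigma
  rw [sigma_one_eq_prod_geomSum hN.ne_zero, ← mul_prod_erase _ _ hp] at h9
  refine Nat.Coprime.dvd_of_dvd_mul_right (Nat.Coprime.prod_right fun r hr => ?_) h9
  refine Nat.Coprime.pow_left 2 ((Nat.prime_three.coprime_iff_not_dvd).2 fun hd => ?_)
  obtain ⟨hne, hmem⟩ := mem_erase.1 hr
  obtain ⟨h4, h5⟩ := hN.modEq_one_three hmem hd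
  exact hne (h r hmem h4 h5)

end IsFriendOfTen

/-! ### Bounds by products of p / (p - 1) -/

/-- The factor `p / (p - 1)`, the supremum of the abundancy indices of powers of `p`. -/
def eulerRatio (p : ℕ) : ℚ := p / (p - 1)

theorem eulerRatio_pos {p : ℕ} (hp : 2 ≤ p) : 0 < eulerRatio p := by
  have : (2 : ℚ) ≤ p := by exact_mod_cast hp
  exact div_pos (by linarith) (by linarith)

theorem eulerRatio_anti {a b : ℕ} (ha : 2 ≤ a) (h : a ≤ b) : eulerRatio b ≤ eulerRatio a := by
  have h1 : (2 : ℚ) ≤ a := by exact_mod_cast ha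
  have h2 : (a : ℚ) ≤ b := by exact_mod_cast h
  unfold eulerRatio
  rw [div_le_div_iff₀ (by linarith) (by linarith)]
  linarith

/-- Every set of at most `k` primes `p ≥ m` satisfies `∏ p / (p - 1) ≤ B`. -/
def EulerBound (m k : ℕ) (B : ℚ) : Prop :=
  ∀ S : Finset ℕ, (∀ p ∈ S, p.Prime ∧ m ≤ p) → #S ≤ k → ∏ p ∈ S, eulerRatio p ≤ B

theorem eulerBound_zero (m : ℕ) : EulerBound m 0 1 := by
  intro S _ hS
  simp [card_eq_zero.1 (Nat.le_zero.1 hS)]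

/-- Split off the least element: its ratio is at most that of m, and the others are primes at least
m'. -/
theorem EulerBound.succ {m m' k : ℕ} {B : ℚ} (h : EulerBound m' k B) (hm : 2 ≤ m)
    (hmm : ∀ p : ℕ, p.Prime → m < p → m' ≤ p) : EulerBound m (k + 1) (eulerRatio m * B) := by
  have hB : 1 ≤ B := by simpa using h ∅ (by simp) (by simp)
  intro S hS hk
  rcases S.eq_empty_or_nonempty with rfl | hne
  · have h1 : 1 ≤ eulerRatio m := by
      have : (2 : ℚ) ≤ m := by exact_mod_cast hm
      unfold eulerRatio
      rw [le_div_iff₀ (by linarith)]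
      linarith
    simpa using one_le_mul_of_one_le_of_one_le h1 hB
  · have hmin := S.min'_mem hne
    rw [← mul_prod_erase _ _ hmin]
    refine mul_le_mul (eulerRatio_anti hm (hS _ hmin).2) (h _ ?_ ?_)
      (prod_nonneg fun p hp => ?_) (eulerRatio_pos hm).le
    · intro p hp
      have hp' := mem_of_mem_erase hp
      have hlt := S.min'_lt_of_mem_erase_min' hne hp
      exact ⟨(hS p hp').1, hmm p (hS p hp').1 ((hS _ hmin).2.trans_lt hlt)⟩
    · rw [card_erase_of_mem hmin]
      omega
    · exact (eulerRatio_pos (hS p (mem_of_mem_erase hp)).1.two_le).le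

theorem IsFriendOfTen.le_prod_eulerRatio {N : ℕ} (hN : IsFriendOfTen N) :
    9 / 5 ≤ ∏ p ∈ N.primeFactors, eulerRatio p := by
  have hN0 : (0 : ℚ) < N := by exact_mod_cast Nat.pos_of_ne_zero hN.ne_zero
  have h1 : (5 * ArithmeticFunction.sigma 1 N : ℚ) = 9 * N := by exact_mod_cast hN.five_mul_sigma
  have h2 : (N : ℚ) = ∏ p ∈ N.primeFactors, (p : ℚ) ^ N.factorization p := by
    conv_lhs => rw [← Nat.prod_factorization_pow_eq_self hN.ne_zero]
    rw [Nat.prod_factorization_eq_prod_primeFactors]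
    push_cast
    rfl
  have h3 : (ArithmeticFunction.sigma 1 N : ℚ) ≤
      ∏ p ∈ N.primeFactors, (eulerRatio p * (p : ℚ) ^ N.factorization p) := by
    rw [sigma_one_eq_prod_geomSum hN.ne_zero]
    push_cast
    refine prod_le_prod (fun p _ => by positivity) fun p hp => ?_
    have hp2 : (2 : ℚ) ≤ p := by exact_mod_cast (Nat.prime_of_mem_primeFactors hp).two_le
    have h4 : (geomSum p (N.factorization p + 1) : ℚ) * (p - 1) =
        (p : ℚ) ^ (N.factorization p + 1) - 1 := by
      exact_mod_cast geomSum_mul_sub_one p (N.factorization p + 1)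
    rw [eulerRatio, div_mul_eq_mul_div, le_div_iff₀ (by linarith), h4, pow_succ']
    linarith
  rw [prod_mul_distrib, ← h2] at h3
  refine le_of_mul_le_mul_right ?_ hN0
  linarith

theorem IsFriendOfTen.le_prod_mul {N : ℕ} (hN : IsFriendOfTen N) {T : Finset ℕ} {m k : ℕ} {B : ℚ}
    (hT : T ⊆ N.primeFactors) (hk : #N.primeFactors ≤ #T + k)
    (hm : ∀ p ∈ N.primeFactors, p ∉ T → m ≤ p) (hB : EulerBound m k B) :
    9 / 5 ≤ (∏ p ∈ T, eulerRatio p) * B := by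
  have h1 := hN.le_prod_eulerRatio
  rw [← prod_sdiff hT, mul_comm] at h1
  refine h1.trans (mul_le_mul_of_nonneg_left (hB _ ?_ ?_) (prod_nonneg fun p hp => ?_))
  · intro p hp
    obtain ⟨hp1, hp2⟩ := mem_sdiff.1 hp
    exact ⟨Nat.prime_of_mem_primeFactors hp1, hm p hp1 hp2⟩
  · rw [card_sdiff_of_subset hT]
    omega
  · exact (eulerRatio_pos (Nat.prime_of_mem_primeFactors (hT hp)).two_le).le

theorem eulerBound_one {m : ℕ} (hm : 2 ≤ m) : EulerBound m 1 (eulerRatio m) := by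
  simpa using (eulerBound_zero m).succ hm fun _ _ h => h.le

theorem eulerBound_two_thirteen : EulerBound 13 2 (eulerRatio 13 * eulerRatio 17) := by
  refine (eulerBound_one (by norm_num)).succ (by norm_num) fun p hp h => ?_
  by_contra! h'
  interval_cases p <;> norm_num at hp

theorem eulerBound_two_seventeen : EulerBound 17 2 (eulerRatio 17 * eulerRatio 19) := by
  refine (eulerBound_one (by norm_num)).succ (by norm_num) fun p hp h => ?_
  by_contra! h'
  interval_cases p; norm_num at hp

theorem eulerBound_five_eleven : EulerBound 11 5
    (eulerRatio 11 * (eulerRatio 13 * (eulerRatio 17 * (eulerRatio 19 * eulerRatio 23)))) := by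
  refine (((eulerBound_one (m := 23) (by norm_num)).succ (by norm_num) ?_).succ
    (by norm_num) ?_ |>.succ (by norm_num) ?_).succ (by norm_num) ?_
  all_goals
    intro p hp h
    by_contra! h'
    interval_cases p <;> norm_num at hp

/-! ### Excluding six or fewer prime factors -/

namespace IsFriendOfTen

variable {N : ℕ}

theorem five_mul_prod_geomSum_le (hN : IsFriendOfTen N) {s : Finset ℕ}
    (hs : s ⊆ N.primeFactors) : 5 * ∏ p ∈ s, geomSum p 3 ≤ 9 * ∏ p ∈ s, p ^ 2 := by
  have hc : (s : Set ℕ).Pairwise (Function.onFun Nat.Coprime fun p => p ^ 2) :=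
    fun p hp q hq hne => Nat.coprime_pow_primes _ _ (Nat.prime_of_mem_primeFactors (hs hp))
      (Nat.prime_of_mem_primeFactors (hs hq)) hne
  have hd : ∏ p ∈ s, p ^ 2 ∣ N := prod_dvd_of_isRelPrime
    (fun p hp q hq hne => Nat.coprime_iff_isRelPrime.1 (hc hp hq hne)) fun p hp => hN.sq_dvd (hs hp)
  have h := hN.five_mul_sigma_le hd
  rw [ArithmeticFunction.IsMultiplicative.map_prod _
    ArithmeticFunction.isMultiplicative_sigma _ hc] at h
  convert h using 2
  refine prod_congr rfl fun p hp => ?_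
  rw [ArithmeticFunction.sigma_one_apply_prime_pow (Nat.prime_of_mem_primeFactors (hs hp))]
  rfl

/-- The known primes `l` may be replaced by lower bounds `l'`, which makes the product numerical; B
accounts for the unlisted primes. -/
theorem le_prod_list_mul (hN : IsFriendOfTen N) {m k : ℕ} {B : ℚ} (hB : EulerBound m k B)
    (l l' : List ℕ) (hll : List.Forall₂ (fun a b => 2 ≤ a ∧ a ≤ b) l' l) (hl : l.Nodup)
    (hT : ∀ p ∈ l, p ∈ N.primeFactors) (hk : #N.primeFactors ≤ l.length + k)
    (hm : ∀ p ∈ N.primeFactors, p ∉ l → m ≤ p) :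
    9 / 5 ≤ (l'.map eulerRatio).prod * B := by
  have hB1 : 1 ≤ B := by simpa using hB ∅ (by simp) (by simp)
  have h1 := hN.le_prod_mul (T := l.toFinset) (fun p hp => hT p (List.mem_toFinset.1 hp))
    (by rwa [List.toFinset_card_of_nodup hl]) (fun p hp h => hm p hp fun h' =>
      h (List.mem_toFinset.2 h')) hB
  rw [List.prod_toFinset _ hl] at h1
  refine h1.trans (mul_le_mul_of_nonneg_right ?_ (by linarith))
  clear h1 hm hk hT hl
  have : 0 ≤ (l.map eulerRatio).prod ∧
      (l.map eulerRatio).prod ≤ (l'.map eulerRatio).prod := by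
    induction hll with
    | nil => simp
    | cons hab _ ih =>
      simp only [List.map_cons, List.prod_cons]
      have h2 := eulerRatio_pos hab.1
      have h3 := eulerRatio_pos (hab.1.trans hab.2)
      exact ⟨mul_nonneg h3.le ih.1, mul_le_mul (eulerRatio_anti hab.1 hab.2) ih.2 ih.1 h2.le⟩
  exact this.2

theorem mem_list_of_card_le {l : List ℕ} (hl : l.Nodup) (hT : ∀ p ∈ l, p ∈ N.primeFactors)
    (hk : #N.primeFactors ≤ l.length) {q : ℕ} (hq : q ∈ N.primeFactors) : q ∈ l := by
  rw [← List.toFinset_card_of_nodup hl] at hk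
  rw [← List.mem_toFinset, eq_of_subset_of_card_le (fun p hp => hT p (List.mem_toFinset.1 hp)) hk]
  exact hq

theorem mem_seven (hN : IsFriendOfTen N) (hc : #N.primeFactors ≤ 6) : 7 ∈ N.primeFactors := by
  by_contra h7
  have h := hN.le_prod_list_mul eulerBound_five_eleven [5] [5] (by simp) (by simp)
    (by simp only [List.forall_mem_cons]; simpa using hN.five_mem) hc (by
      intro q hq hql
      have h5 := hN.five_le hq
      have hpr := Nat.prime_of_mem_primeFactors hq
      by_contra! hlt
      interval_cases q <;> first | (apply hql; simp; done) | exact h7 hq | norm_num at hpr)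
  norm_num [eulerRatio] at h

theorem notMem_of_mem_thirteen (hN : IsFriendOfTen N) (h7 : 7 ∈ N.primeFactors)
    (h11 : 11 ∈ N.primeFactors) (h13 : 13 ∈ N.primeFactors) :
    17 ∉ N.primeFactors ∧ 19 ∉ N.primeFactors := by
  have h5 := hN.five_mem
  constructor
  · intro h
    have := hN.five_mul_prod_geomSum_le (s := {5, 7, 11, 13, 17}) (by
      simp only [insert_subset_iff, singleton_subset_iff]; exact ⟨h5, h7, h11, h13, h⟩)
    revert this
    decide
  · intro h
    have := hN.five_mul_prod_geomSum_le (s := {5, 7, 11, 13, 19}) (by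
      simp only [insert_subset_iff, singleton_subset_iff]; exact ⟨h5, h7, h11, h13, h⟩)
    revert this
    decide

theorem notMem_3221 (hN : IsFriendOfTen N) (hc : #N.primeFactors ≤ 6)
    (h11 : 11 ∈ N.primeFactors) : 3221 ∉ N.primeFactors := by
  intro h3221
  have h5 := hN.five_mem
  have h7 := hN.mem_seven hc
  have h13 : 13 ∈ N.primeFactors := by
    by_contra h13
    have h := hN.le_prod_list_mul eulerBound_two_seventeen [5, 7, 11, 3221] [5, 7, 11, 3221]
      (by simp) (by simp) (by simp only [List.forall_mem_cons]; simp only [*]; simp) hc (by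
        intro q hq hql
        have h5 := hN.five_le hq
        have hpr := Nat.prime_of_mem_primeFactors hq
        by_contra! hlt
        interval_cases q <;> first | (apply hql; simp; done) | exact h13 hq | norm_num at hpr)
    norm_num [eulerRatio] at h
  obtain ⟨h17, h19⟩ := hN.notMem_of_mem_thirteen h7 h11 h13
  have hz : 23 ∈ N.primeFactors ∨ 29 ∈ N.primeFactors := by
    by_contra! hz
    have h := hN.le_prod_list_mul (eulerBound_one (m := 31) (by norm_num))
      [5, 7, 11, 13, 3221] [5, 7, 11, 13, 3221]
      (by simp) (by simp) (by simp only [List.forall_mem_cons]; simp only [*]; simp) hc (by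
        intro q hq hql
        have h5 := hN.five_le hq
        have hpr := Nat.prime_of_mem_primeFactors hq
        by_contra! hlt
        interval_cases q <;> first
          | (apply hql; simp; done) | exact h17 hq | exact h19 hq | exact hz.1 hq | exact hz.2 hq
          | norm_num at hpr)
    norm_num [eulerRatio] at h
  obtain ⟨z, hz, hzS⟩ : ∃ z, (z = 23 ∨ z = 29) ∧ z ∈ N.primeFactors := by
    rcases hz with hz | hz
    · exact ⟨23, .inl rfl, hz⟩
    · exact ⟨29, .inr rfl, hz⟩
  have hmem : ∀ q ∈ N.primeFactors, q ∈ [5, 7, 11, 13, 3221, z] := fun q hq =>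
    mem_list_of_card_le (by rcases hz with rfl | rfl <;> simp)
      (by simp only [List.forall_mem_cons]; simp only [*]; simp) hc hq
  -- Only 7 and 13 are 1 mod 3, and 7² + 7 + 1 = 3 · 19, 13² + 13 + 1 = 3 · 61 bring in a seventh
  -- prime.
  obtain ⟨q, hq, h1, h3⟩ := hN.exists_modEq_one_three
  have hq' := hmem q hq
  simp only [List.mem_cons, List.not_mem_nil, or_false] at hq'
  rcases hq' with rfl | rfl | rfl | rfl | rfl | rfl
  · revert h1; decide
  · have := hmem 19 (hN.mem_primeFactors hq h3 (by norm_num) (by norm_num) (by decide))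
    rcases hz with rfl | rfl <;> simp at this
  · revert h1; decide
  · have := hmem 61 (hN.mem_primeFactors hq h3 (by norm_num) (by norm_num) (by decide))
    rcases hz with rfl | rfl <;> simp at this
  · revert h1; decide
  · rcases hz with rfl | rfl <;> revert h1 <;> decide

theorem thirtyone_le {p : ℕ} (hp : p.Prime) (h1 : p ≡ 1 [MOD 10]) (h11 : p ≠ 11) : 31 ≤ p := by
  by_contra! hlt
  have := hp.two_le
  unfold Nat.ModEq at h1
  obtain rfl : p = 21 := by omega
  norm_num at hp

/-- Besides `p` and `11` no `r ≡ 1 [MOD 10]` is a prime factor when there are at most six. -/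
theorem notMem_of_modEq_one (hN : IsFriendOfTen N) (hc : #N.primeFactors ≤ 6) {p r : ℕ}
    (hp : p ∈ N.primeFactors) (hp1 : p ≡ 1 [MOD 10]) (hp31 : 31 ≤ p)
    (he : 5 ∣ N.factorization p + 1) (h11 : 11 ∈ N.primeFactors)
    (hr5 : r ≠ 5) (hr11 : r ≠ 11) (hr : r.Prime) (hrp : r ∣ geomSum p 5) : False := by
  have h5 := hN.five_mem
  have h7 := hN.mem_seven hc
  have key : ∀ s : ℕ, s.Prime → s ∣ geomSum p 5 → s ≠ 5 → s ≠ 11 →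
      s ∈ N.primeFactors ∧ 31 ≤ s ∧ s ≡ 1 [MOD 10] ∧ s ≠ p := by
    intro s hs hd hs5 hs11
    have hs1 := (prime_dvd_geomSum_five hs hd).resolve_left hs5
    have h31 := thirtyone_le hs hs1 hs11
    refine ⟨hN.mem_primeFactors hp he hs (by omega) hd, h31, hs1, ?_⟩
    rintro rfl
    rw [geomSum_five] at hd
    have : s ∣ 1 := by
      rw [show 1 + s + s ^ 2 + s ^ 3 + s ^ 4 = 1 + s * (1 + s + s ^ 2 + s ^ 3) by ring] at hd
      exact (Nat.dvd_add_left (dvd_mul_right _ _)).1 hd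
    exact hs.one_lt.ne' (Nat.dvd_one.1 this)
  obtain ⟨hrS, hr31, hr1, hrne⟩ := key r hr hrp hr5 hr11
  have hpp := Nat.prime_of_mem_primeFactors hp
  have bound : ∀ a b : ℕ, 2 ≤ a → 2 ≤ b → a ≤ p → b ≤ r →
      9 / 5 ≤ (([5, 7, 11, a, b] : List ℕ).map eulerRatio).prod * eulerRatio 13 := by
    intro a b ha hb hap hbr
    refine hN.le_prod_list_mul (eulerBound_one (m := 13) (by norm_num))
      [5, 7, 11, p, r] [5, 7, 11, a, b] (by simp [*]) (by simp; omega)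
      (by simp only [List.forall_mem_cons]; simp only [*]; simp) hc ?_
    intro q hq hql
    have h5 := hN.five_le hq
    have hpr := Nat.prime_of_mem_primeFactors hq
    by_contra! hlt
    interval_cases q <;> first | (apply hql; simp; done) | norm_num at hpr
  have next : ∀ s : ℕ, s.Prime → s ≡ 1 [MOD 10] → 31 ≤ s → s ≠ 31 → 41 ≤ s ∧ (s ≠ 41 → 61 ≤ s) := by
    intro s hs hs1 h31 hne
    unfold Nat.ModEq at hs1
    refine ⟨by omega, fun h41 => ?_⟩
    by_contra! hlt
    obtain rfl : s = 51 := by omega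
    norm_num at hs
  by_cases hp31' : p = 31
  · subst hp31'
    have hr' : r ∣ 5 * 11 * 17351 := by simpa [geomSum_five] using hrp
    have : 17351 ≤ r := by
      rcases hr.dvd_mul.1 hr' with h | h
      · rcases hr.dvd_mul.1 h with h | h
        · exact absurd ((Nat.prime_dvd_prime_iff_eq hr (by norm_num)).1 h) hr5
        · exact absurd ((Nat.prime_dvd_prime_iff_eq hr (by norm_num)).1 h) hr11
      · exact ((Nat.prime_dvd_prime_iff_eq hr (by norm_num)).1 h).ge
    have h := bound 31 17351 (by norm_num) (by norm_num) le_rfl this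
    norm_num [eulerRatio] at h
  obtain ⟨hp41, hp61⟩ := next p hpp hp1 hp31 hp31'
  by_cases hp41' : p = 41
  · subst hp41'
    have hr' : r ∣ 5 * 579281 := by simpa [geomSum_five] using hrp
    have : 579281 ≤ r := by
      rcases hr.dvd_mul.1 hr' with h | h
      · exact absurd ((Nat.prime_dvd_prime_iff_eq hr (by norm_num)).1 h) hr5
      · exact ((Nat.prime_dvd_prime_iff_eq hr (by norm_num)).1 h).ge
    have h := bound 41 579281 (by norm_num) (by norm_num) le_rfl this
    norm_num [eulerRatio] at h
  replace hp61 := hp61 hp41'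
  by_cases hr31' : r = 31
  · subst hr31'
    -- The product bound with r = 31 allows only p ≤ 426.
    have hlt : p < 431 := by
      by_contra! hge
      have h := bound 431 31 (by norm_num) (by norm_num) hge le_rfl
      norm_num [eulerRatio] at h
    obtain ⟨s, hs, hd, hs5, hs11, hs31⟩ :=
      exists_prime_dvd_geomSum_five_ne_thirtyone hp1 (by omega) hlt
    obtain ⟨hsS, hs31', hs1, hsp⟩ := key s hs hd hs5 hs11
    have hs41 := (next s hs hs1 hs31' hs31).1
    have h := hN.le_prod_list_mul (eulerBound_zero 0)
      [5, 7, 11, 31, p, s] [5, 7, 11, 31, 61, 41] (by simp [*]) (by simp; omega)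
      (by simp only [List.forall_mem_cons]; simp only [*]; simp) hc (by simp)
    norm_num [eulerRatio] at h
  obtain ⟨hr41, hr61⟩ := next r hr hr1 hr31 hr31'
  by_cases hr41' : r = 41
  · subst hr41'
    have hlt : p < 97 := by
      by_contra! hge
      have h := bound 97 41 (by norm_num) (by norm_num) hge le_rfl
      norm_num [eulerRatio] at h
    unfold Nat.ModEq at hp1
    obtain rfl | rfl | rfl | rfl : p = 61 ∨ p = 71 ∨ p = 81 ∨ p = 91 := by omega
    · revert hrp; decide
    · revert hrp; decide
    · norm_num at hpp
    · norm_num at hpp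
  · have h := bound 61 61 (by norm_num) (by norm_num) hp61 (hr61 hr41')
    norm_num [eulerRatio] at h

theorem mem_eleven (hN : IsFriendOfTen N) (hc : #N.primeFactors ≤ 6) {p : ℕ}
    (hp : p ∈ N.primeFactors) (hp1 : p ≡ 1 [MOD 10]) (he : 5 ∣ N.factorization p + 1) :
    11 ∈ N.primeFactors := by
  by_contra h11
  have hp11 : p ≠ 11 := by rintro rfl; exact h11 hp
  have h5 := hN.five_mem
  have h7 := hN.mem_seven hc
  have hp31 := thirtyone_le (Nat.prime_of_mem_primeFactors hp) hp1 hp11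
  -- 5 divides the sum exactly once, so the cofactor m supplies a second prime r ≡ 1 mod 10 of N.
  obtain ⟨m, hm⟩ : 5 ∣ geomSum p 5 :=
    Nat.modEq_zero_iff_dvd.1 ((geomSum_modEq (hp1.of_dvd (by norm_num)) 5).trans (by decide))
  have hm5 : ¬ 5 ∣ m := fun ⟨k, hk⟩ =>
    not_twentyfive_dvd_geomSum_five p ⟨k, by rw [hm, hk]; ring⟩
  have hm1 : m ≠ 1 := by
    rintro rfl
    rw [geomSum_five] at hm
    have := Nat.zero_le (p ^ 2 + p ^ 3 + p ^ 4)
    omega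
  obtain ⟨r, hr, hrm⟩ := Nat.exists_prime_and_dvd hm1
  have hrd : r ∣ geomSum p 5 := hm ▸ hrm.mul_left 5
  have hr1 := (prime_dvd_geomSum_five hr hrd).resolve_left (by rintro rfl; exact hm5 hrm)
  have hrS : r ∈ N.primeFactors := hN.mem_primeFactors hp he hr
    (by rintro rfl; revert hr1; decide) hrd
  have hr31 := thirtyone_le hr hr1 (by rintro rfl; exact h11 hrS)
  have hrp : r ≠ p := by
    rintro rfl
    rw [geomSum_five, show 1 + r + r ^ 2 + r ^ 3 + r ^ 4 = 1 + r * (1 + r + r ^ 2 + r ^ 3) by ring]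
      at hrd
    exact hr.one_lt.ne' (Nat.dvd_one.1 ((Nat.dvd_add_left (dvd_mul_right _ _)).1 hrd))
  have hm' : ∀ q ∈ N.primeFactors, q ∉ [5, 7, p, r] → 13 ≤ q := by
    intro q hq hql
    have h5 := hN.five_le hq
    have hpr := Nat.prime_of_mem_primeFactors hq
    by_contra! hlt
    interval_cases q <;> first | (apply hql; simp; done) | exact h11 hq | norm_num at hpr
  have bound : ∀ a b : ℕ, 2 ≤ a → 2 ≤ b → a ≤ p → b ≤ r →
      9 / 5 ≤ (([5, 7, a, b] : List ℕ).map eulerRatio).prod * (eulerRatio 13 * eulerRatio 17) := by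
    intro a b ha hb hap hbr
    exact hN.le_prod_list_mul eulerBound_two_thirteen
      [5, 7, p, r] [5, 7, a, b] (by simp [*]) (by simp; omega)
      (by simp only [List.forall_mem_cons]; simp only [*]; simp) hc hm'
  have : 41 ≤ p ∨ 41 ≤ r := by
    unfold Nat.ModEq at hp1 hr1
    omega
  rcases this with h | h
  · have h := bound 41 31 (by norm_num) (by norm_num) h hr31
    norm_num [eulerRatio] at h
  · have h := bound 31 41 (by norm_num) (by norm_num) hp31 h
    norm_num [eulerRatio] at h

theorem lt_or_mem_twentythree (hN : IsFriendOfTen N) (hc : #N.primeFactors ≤ 6)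
    {p : ℕ} (hp : p ∈ N.primeFactors) (h11 : 11 ∈ N.primeFactors) :
    p < 20800 ∨ 13 ∈ N.primeFactors ∧ 23 ∈ N.primeFactors := by
  have h5 := hN.five_mem
  have h7 := hN.mem_seven hc
  by_contra! hcon
  obtain ⟨hge, hcon⟩ := hcon
  by_cases h13 : 13 ∈ N.primeFactors
  · have h23 := hcon h13
    obtain ⟨h17, h19⟩ := hN.notMem_of_mem_thirteen h7 h11 h13
    -- The ratios of 5, 7, 11, 13, 29 multiply to 145145/80640, while 9/5 = 145152/80640; this would
    -- force p ≤ 20736.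
    have h := hN.le_prod_list_mul (eulerBound_one (m := 29) (by norm_num))
      [5, 7, 11, 13, p] [5, 7, 11, 13, 20800] (by simp [*]) (by simp; omega)
      (by simp only [List.forall_mem_cons]; simp only [*]; simp) hc (by
        intro q hq hql
        have h5 := hN.five_le hq
        have hpr := Nat.prime_of_mem_primeFactors hq
        by_contra! hlt
        interval_cases q <;> first
          | (apply hql; simp; done) | exact h17 hq | exact h19 hq | exact h23 hq | norm_num at hpr)
    norm_num [eulerRatio] at h
  · have h := hN.le_prod_list_mul eulerBound_two_seventeen
      [5, 7, 11, p] [5, 7, 11, 20800] (by simp [*]) (by simp; omega)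
      (by simp only [List.forall_mem_cons]; simp only [*]; simp) hc (by
        intro q hq hql
        have h5 := hN.five_le hq
        have hpr := Nat.prime_of_mem_primeFactors hq
        by_contra! hlt
        interval_cases q <;> first | (apply hql; simp; done) | exact h13 hq | norm_num at hpr)
    norm_num [eulerRatio] at h

theorem six_lt_card (hN : IsFriendOfTen N) : 6 < #N.primeFactors := by
  by_contra! hc
  obtain ⟨p, hp, hp1, he⟩ := hN.exists_modEq_one_five
  have h5 := hN.five_mem
  have h7 := hN.mem_seven hc
  have h11 := hN.mem_eleven hc hp hp1 he
  have hpp := Nat.prime_of_mem_primeFactors hp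
  by_cases hp11 : p = 11
  · subst hp11
    exact hN.notMem_3221 hc h11 (hN.mem_primeFactors hp he (by norm_num) (by norm_num) (by decide))
  have hp31 := thirtyone_le hpp hp1 hp11
  have hge : 20800 ≤ p := by
    by_contra! hlt
    obtain ⟨r, hr, hrp, hr5, hr11⟩ := exists_prime_dvd_geomSum_five_of_lt hp1 (by omega) hlt
    exact hN.notMem_of_modEq_one hc hp hp1 hp31 he h11 hr5 hr11 hr hrp
  obtain ⟨h13, h23⟩ :=
    (hN.lt_or_mem_twentythree hc hp h11).resolve_left (by omega)
  have hmem : ∀ q ∈ N.primeFactors, q ∈ [5, 7, 11, 13, 23, p] := fun q hq =>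
    mem_list_of_card_le (by simp; omega)
      (by simp only [List.forall_mem_cons]; simp only [*]; simp) hc hq
  obtain ⟨h1, h9⟩ := hN.nine_dvd_factorization hp (by
    intro q hq h1 h3
    have hq' := hmem q hq
    simp only [List.mem_cons, List.not_mem_nil, or_false] at hq'
    rcases hq' with rfl | rfl | rfl | rfl | rfl | rfl
    · exact absurd h1 (by decide)
    · have := hmem 19 (hN.mem_primeFactors hq h3 (by norm_num) (by norm_num) (by decide))
      simp at this; omega
    · exact absurd h1 (by decide)
    · have := hmem 61 (hN.mem_primeFactors hq h3 (by norm_num) (by norm_num) (by decide))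
      simp at this; omega
    · exact absurd h1 (by decide)
    · rfl)
  obtain ⟨t, ht⟩ : ∃ t, p ^ 3 = 9 * t + 1 := by
    refine ⟨p ^ 3 / 9, ?_⟩
    have h9 : p % 9 = 1 ∨ p % 9 = 4 ∨ p % 9 = 7 := by
      unfold Nat.ModEq at h1
      omega
    have : p ^ 3 % 9 = 1 := by rcases h9 with h9 | h9 | h9 <;> simp [Nat.pow_mod, h9]
    omega
  have hfac : geomSum p 9 = geomSum p 3 * (3 * (27 * t ^ 2 + 9 * t + 1)) := by
    rw [show 9 = 3 * 3 by rfl, geomSum_mul, ht]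
    simp only [geomSum, sum_range_succ, sum_range_zero]
    ring
  have ht0 : t ≠ 0 := by
    rintro rfl
    have : 20800 ^ 3 ≤ p ^ 3 := Nat.pow_le_pow_left hge 3
    omega
  obtain ⟨r, hr, hrd⟩ := Nat.exists_prime_and_dvd (n := 27 * t ^ 2 + 9 * t + 1)
    (by have := Nat.zero_le (t ^ 2); omega)
  have hrS := hN.mem_primeFactors hp h9 hr (by
    rintro rfl
    omega) (hfac ▸ (hrd.mul_left 3).mul_left _)
  have hX : p ^ 6 + p ^ 3 + 1 = 3 * (27 * t ^ 2 + 9 * t + 1) := by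
    rw [show p ^ 6 = p ^ 3 * p ^ 3 by ring, ht]
    ring
  have hrX : r ∣ p ^ 6 + p ^ 3 + 1 := hX ▸ hrd.mul_left 3
  -- A root modulo m would have order 9, but 9 ∤ m - 1 for these primes.
  have hcop : ∀ m ∈ [5, 7, 11, 13, 23], ∀ a < m, (a ^ 6 + a ^ 3 + 1) % m ≠ 0 := by decide
  have hlit : ∀ m ∈ [5, 7, 11, 13, 23], ¬ m ∣ p ^ 6 + p ^ 3 + 1 := by
    intro m hm hd
    have hm0 : 0 < m := Nat.pos_of_ne_zero (by rintro rfl; simp at hm)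
    refine hcop m hm (p % m) (Nat.mod_lt _ hm0) ?_
    have h : (p % m) ^ 6 + (p % m) ^ 3 + 1 ≡ p ^ 6 + p ^ 3 + 1 [MOD m] :=
      (((Nat.mod_modEq p m).pow 6).add ((Nat.mod_modEq p m).pow 3)).add_right 1
    exact h.trans (Nat.modEq_zero_iff_dvd.2 hd)
  have hr' := hmem r hrS
  by_cases hrp : r = p
  · subst hrp
    have h6 : r ∣ r ^ 6 + r ^ 3 := (dvd_pow_self r (by norm_num)).add (dvd_pow_self r (by norm_num))
    exact hr.one_lt.ne' (Nat.dvd_one.1 ((Nat.dvd_add_right h6).1 hrX))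
  · refine hlit r ?_ hrX
    simp only [List.mem_cons, List.not_mem_nil, or_false] at hr' ⊢
    tauto

end IsFriendOfTen

theorem theorem1p2 (N : ℕ) (hN : IsFriendOfTen N) :
    7 ≤ N.primeFactors.card ∧
    (∃ p : ℕ, p.Prime ∧ p ∣ N ∧ p ≡ 1 [MOD 10]) ∧
    (∃ q : ℕ, q.Prime ∧ q ∣ N ∧ q ≡ 1 [MOD 6]) := by
  refine ⟨hN.six_lt_card, ?_, ?_⟩
  · obtain ⟨p, hp, h1, _⟩ := hN.exists_modEq_one_five
    exact ⟨p, Nat.prime_of_mem_primeFactors hp, Nat.dvd_of_mem_primeFactors hp, h1⟩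
  · obtain ⟨q, hq, h1, _⟩ := hN.exists_modEq_one_three
    refine ⟨q, Nat.prime_of_mem_primeFactors hq, Nat.dvd_of_mem_primeFactors hq, ?_⟩
    have := hN.odd_prime (Nat.dvd_of_mem_primeFactors hq)
    unfold Nat.ModEq at *
    omega
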